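/- Let $r \ge 1$ and let $n$ be a natural number with $n \equiv 3r \pmod{4r}$, i.e. $n = (4m-1)r$ for some integer $m \ge 1$. Consider labeled chip-firing on the line $\mathbb{Z}$ in which each pair of neighboring sites is joined by $r$ parallel edges and each site carries $r$ self-loops: a firing move consists of choosing a site $i$ and any $3r$ chips located at $i$, moving the $r$ chips with the smallest labels among them to $i-1$ and the $r$ chips with the largest labels among them to $i+1$, and leaving all other chips in place. Start with $n$ chips, labeled $1, \dots, n$, all at site $0$. Then, whatever moves are chosen, the process terminates after finitely many moves (there is no infinite sequence of firing moves), and every final configuration it can reach (one in which no firing move is possible) is weakly sorted: for all labels $a < b$, the final position of chip $a$ is at or to the left of the final position of chip $b$. -/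

import Mathlib

namespace LabeledChipFiring

/-- A configuration of `n` labeled chips on the line: the chip with label `a` is at site `p a`.
Labels are the elements of `Fin n`, with their usual order. -/
abbrev Config (n : ℕ) : Type := Fin n → ℤ

/-- The configuration with all chips at the origin. -/
def atOrigin (n : ℕ) : Config n := fun _ => 0

/-- The chips of `S` that are among the `r` smallest chips of `S`. -/
def smallest {n : ℕ} (r : ℕ) (S : Finset (Fin n)) : Finset (Fin n) :=
  S.filter fun a => (S.filter fun b => b < a).card < r

/-- The chips of `S` that are among the `r` largest chips of `S`. -/
def largest {n : ℕ} (r : ℕ) (S : Finset (Fin n)) : Finset (Fin n) :=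
  S.filter fun a => (S.filter fun b => a < b).card < r

/-- `Fires r p q`: on the line with `r` parallel edges between neighbors and `r` self-loops at
each site, a single firing move leads from `p` to `q`. The move chooses a site `i` and a set `S`
of `3 * r` chips at `i`; the `r` smallest chips of `S` go to `i - 1`, the `r` largest chips of `S`
go to `i + 1`, and all other chips (the `r` middle ones of `S` and those outside `S`) stay. -/
def Fires {n : ℕ} (r : ℕ) (p q : Config n) : Prop :=
  ∃ (i : ℤ) (S : Finset (Fin n)), S.card = 3 * r ∧ (∀ a ∈ S, p a = i) ∧
    (∀ a ∈ smallest r S, q a = i - 1) ∧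
    (∀ a ∈ largest r S, q a = i + 1) ∧
    (∀ a, a ∉ smallest r S → a ∉ largest r S → q a = p a)

/-- A configuration is reachable if finitely many (possibly zero) firing moves lead to it from
the configuration with all chips at the origin. -/
def Reachable {n : ℕ} (r : ℕ) (p : Config n) : Prop :=
  Relation.ReflTransGen (Fires r) (atOrigin n) p

/-- A configuration is final if no firing move can be performed. -/
def IsFinal {n : ℕ} (r : ℕ) (p : Config n) : Prop :=
  ∀ q : Config n, ¬ Fires r p q

/-- Weakly sorted: a chip with a smaller label is at or to the left of any chip with a larger
label. -/
def WeaklySorted {n : ℕ} (p : Config n) : Prop :=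
  ∀ a b : Fin n, a < b → p a ≤ p b

end LabeledChipFiring

/-! Write n = r(4m-1) and, for 1 ≤ t ≤ m, call the r(2t-1) lowest chips small and the others large.
In units of r, the final loads are 1 at 0 and at ±m, and 2 at the other sites between, so exactly
r(2t-1) chips end left of t-m. It therefore suffices that every small chip ends there
(`lt_iff_of_isFinal`). Letting t vary sorts the left half, and reflection sorts the right half.

The labels enter only through this two-colouring. Counting small chips in units of r, rounded up,
turns a labeled move into a move of a process in which single chips fire in triples
(`unitStep_bundled`).

Two estimates control that process. The first is a potential: the total excess of the small chips
beyond a site i grows only when three small chips fire at i, so it stays below a quadratic with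
second difference at most 2; likewise for large chips on the left (`Spread.step`). The second is
rigidity near the end: an interval of L sites that have all fired holds at least 2L-1 chips
(`Good.step`). Hence, once at most m-|z| firings remain at z, this site fires only with exactly
three chips and in lockstep with its neighbors (`Good.todo_at_step`, `Good.load_at_step`). The
potential bounds the small chips at or right of y when y enters this regime
(`Spread.endBound_of_eq`). The rigidity carries the bound to the end (`EndBounded.step`), where it
is 0 at y = t-m. -/

namespace LabeledChipFiring

/-! ### The unlabeled process and its odometer -/

/-- The number of times site `i` fires altogether, in the unlabeled process with `4 * m - 1`
chips, one self-loop and simple edges. -/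
def finalOdo (m i : ℤ) : ℤ := max 0 (m - |i|) ^ 2

/-- The number of chips at or to the right of `y`, given the odometer `f`. -/
def tail (m : ℤ) (f : ℤ → ℤ) (y : ℤ) : ℤ := (if y ≤ 0 then 4 * m - 1 else 0) + f (y - 1) - f y

/-- The number of chips at `y`, given the odometer `f`. -/
def load (m : ℤ) (f : ℤ → ℤ) (y : ℤ) : ℤ := tail m f y - tail m f (y + 1)

/-- The number of firings that are still to come at site `i`. -/
def todo (m : ℤ) (f : ℤ → ℤ) (i : ℤ) : ℤ := finalOdo m i - f i

lemma finalOdo_neg (m i : ℤ) : finalOdo m (-i) = finalOdo m i := by simp [finalOdo]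

lemma finalOdo_left {m i : ℤ} (h1 : -m ≤ i) (h2 : i ≤ 0) : finalOdo m i = (m + i) ^ 2 := by
  rw [finalOdo, abs_of_nonpos h2, max_eq_right (by omega)]; ring

lemma finalOdo_right {m i : ℤ} (h1 : i ≤ m) (h2 : 0 ≤ i) : finalOdo m i = (m - i) ^ 2 := by
  rw [finalOdo, abs_of_nonneg h2, max_eq_right (by omega)]

lemma finalOdo_of_le {m i : ℤ} (h : m ≤ |i|) : finalOdo m i = 0 := by
  rw [finalOdo, max_eq_left (by omega)]; simp

lemma finalOdo_nonneg (m i : ℤ) : 0 ≤ finalOdo m i := sq_nonneg _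

lemma le_finalOdo (m i : ℤ) : m - |i| ≤ finalOdo m i := by
  unfold finalOdo
  rcases le_total (m - |i|) 0 with h | h
  · rw [max_eq_left h]; simpa using h
  · rw [max_eq_right h]; nlinarith [Int.le_self_sq (m - |i|)]

lemma load_eq (m : ℤ) (f : ℤ → ℤ) (y : ℤ) :
    load m f y = (if y = 0 then 4 * m - 1 else 0) + f (y - 1) + f (y + 1) - 2 * f y := by
  unfold load tail
  rw [show y + 1 - 1 = y by ring]
  split_ifs <;> omega

/-- `finalOdo` leaves at most two chips on each site; this is what the least action argument for `f
≤ finalOdo` needs. -/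
lemma finalOdo_laplacian {m : ℤ} (hm : 1 ≤ m) (i : ℤ) :
    (if i = 0 then 4 * m - 1 else 0) + finalOdo m (i - 1) + finalOdo m (i + 1)
      ≤ 2 * finalOdo m i + 2 := by
  have right : ∀ i : ℤ, 0 < i →
      finalOdo m (i - 1) + finalOdo m (i + 1) ≤ 2 * finalOdo m i + 2 := by
    intro i hi
    rcases lt_trichotomy i m with h | h | h
    · rw [finalOdo_right (by omega) (by omega), finalOdo_right (by omega) (by omega),
        finalOdo_right (by omega) (by omega)]
      nlinarith
    · subst h
      rw [finalOdo_right (by omega) (by omega), finalOdo_of_le (i := i + 1) (le_trans (by omega) (le_abs_self _)),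
        finalOdo_of_le (i := i) (le_abs_self _)]
      ring_nf; norm_num
    · rw [finalOdo_of_le (i := i + 1) (le_trans (by omega) (le_abs_self _)),
        finalOdo_of_le (i := i - 1) (le_trans (by omega) (le_abs_self _)),
        finalOdo_of_le (i := i) (le_trans (by omega) (le_abs_self _))]
      norm_num
  rcases lt_trichotomy i 0 with h | h | h
  · have := right (-i) (by omega)
    rw [if_neg (by omega), ← finalOdo_neg m (i - 1), ← finalOdo_neg m (i + 1), ← finalOdo_neg m i,
      show -(i - 1) = -i + 1 by ring, show -(i + 1) = -i - 1 by ring]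
    omega
  · subst h
    rw [if_pos rfl, finalOdo_left (i := 0 - 1) (by omega) (by omega),
      finalOdo_right (i := 0 + 1) (by omega) (by omega),
      finalOdo_left (i := 0) (by omega) (by omega)]
    nlinarith
  · have := right i h
    rw [if_neg (by omega)]
    omega

/-- Properties of the odometers that occur in the unlabeled process. -/
structure Good (m : ℤ) (f : ℤ → ℤ) : Prop where
  nonneg : ∀ i, 0 ≤ f i
  le : ∀ i, f i ≤ finalOdo m i
  -- The right side is the number of chips on [x, y]. The empty interval x = y + 1 is admitted so
  -- that an interval can be split at its first or last site.
  seg : ∀ x y, x ≤ y + 1 → (∀ j, x ≤ j → j ≤ y → 1 ≤ f j) →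
    2 * (y - x) + 1 ≤ f (y + 1) - f y + f (x - 1) - f x +
      (if x ≤ 0 ∧ 0 ≤ y then 4 * m - 1 else 0)

lemma good_zero {m : ℤ} : Good m (fun _ => 0) where
  nonneg _ := le_rfl
  le i := finalOdo_nonneg m i
  seg x y hxy h := by
    have : y < x := by
      by_contra hc
      exact absurd (h x le_rfl (by omega)) (by norm_num)
    rw [if_neg (by omega)]
    omega

lemma Good.reflect {m : ℤ} {f : ℤ → ℤ} (h : Good m f) : Good m (fun i => f (-i)) where
  nonneg i := h.nonneg _
  le i := by rw [← finalOdo_neg]; exact h.le _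
  seg x y hxy hf := by
    have := h.seg (-y) (-x) (by omega) (fun j h1 h2 => by
      have := hf (-j) (by omega) (by omega)
      simpa using this)
    rw [show -x + 1 = -(x - 1) by ring, show -y - 1 = -(y + 1) by ring] at this
    have e : (if -y ≤ 0 ∧ 0 ≤ -x then 4 * m - 1 else 0) = if x ≤ 0 ∧ 0 ≤ y then 4 * m - 1 else 0 :=
      if_congr (by omega) rfl rfl
    rw [e] at this
    linarith

/-- If z lies in the interval, split there: the two sides hold at least 2L₁-1 and 2L₂-1 chips and z
holds three, which add up to 2(L₁+L₂+1)-1. A chip leaves the interval only past an empty side, whose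
bound -1 pays for it. If z lies outside, the interval loses nothing. -/
lemma Good.step {m : ℤ} (hm : 1 ≤ m) {f : ℤ → ℤ} (h : Good m f) {z : ℤ} (hz : 3 ≤ load m f z) :
    Good m (Function.update f z (f z + 1)) where
  nonneg i := by
    have := h.nonneg i
    by_cases hi : i = z
    · subst hi; rw [Function.update_self]; omega
    · rw [Function.update_of_ne hi]; exact this
  le i := by
    by_cases hi : i = z
    · subst hi
      rw [Function.update_self]
      rw [load_eq] at hz
      have := finalOdo_laplacian hm i
      have := h.le (i - 1)
      have := h.le (i + 1)
      omega
    · rw [Function.update_of_ne hi]; exact h.le i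
  seg x y hxy hf := by
    rw [load_eq] at hz
    by_cases hzs : x ≤ z ∧ z ≤ y
    · have h1 := h.seg x (z - 1) (by omega) (fun j h1 h2 => by
        have := hf j h1 (by omega)
        rwa [Function.update_of_ne (by omega)] at this)
      have h2 := h.seg (z + 1) y (by omega) (fun j h1 h2 => by
        have := hf j (by omega) h2
        rwa [Function.update_of_ne (by omega)] at this)
      rw [show z - 1 + 1 = z by ring] at h1
      rw [show z + 1 - 1 = z by ring] at h2
      rw [Function.update_of_ne (show y + 1 ≠ z by omega),
        Function.update_of_ne (show x - 1 ≠ z by omega)]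
      by_cases hx : x = z <;> by_cases hy : y = z
      · subst hx; subst hy
        rw [Function.update_self]
        split_ifs at hz ⊢ <;> omega
      · subst hx
        rw [Function.update_self, Function.update_of_ne hy]
        split_ifs at hz h1 h2 ⊢ <;> omega
      · subst hy
        rw [Function.update_self, Function.update_of_ne hx]
        split_ifs at hz h1 h2 ⊢ <;> omega
      · rw [Function.update_of_ne hx, Function.update_of_ne hy]
        split_ifs at hz h1 h2 ⊢ <;> omega
    · have h1 := h.seg x y hxy (fun j h1 h2 => by
        have := hf j h1 h2
        rwa [Function.update_of_ne (by omega)] at this)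
      rcases eq_or_lt_of_le hxy with hxy | hxy
      · have e : x - 1 = y := by omega
        rw [if_neg (by omega), e, ← hxy]
        omega
      rw [Function.update_of_ne (show y ≠ z by omega), Function.update_of_ne (show x ≠ z by omega)]
      have g : ∀ j, f j ≤ Function.update f z (f z + 1) j := by
        intro j
        by_cases hj : j = z
        · subst hj; rw [Function.update_self]; omega
        · rw [Function.update_of_ne hj]
      have := g (y + 1)
      have := g (x - 1)
      omega

/-! ### Rigidity of the last firings -/

section chains

variable {m : ℤ} {f : ℤ → ℤ}

lemma Good.todo_nonneg (h : Good m f) (i : ℤ) : 0 ≤ todo m f i := by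
  have := h.le i; unfold todo; omega

lemma fired_of_todo_lt {i : ℤ} (hi : todo m f i < m - |i|) : 1 ≤ f i := by
  have := le_finalOdo m i; unfold todo at hi; omega

lemma Good.todo_of_le (h : Good m f) {i : ℤ} (hi : m ≤ |i|) : todo m f i = 0 := by
  have := h.le i
  have := h.nonneg i
  have := finalOdo_of_le hi
  unfold todo; omega

/-- Near the end, an inner neighbor has at most one more firing to come. -/
lemma Good.todo_inner_le (h : Good m f) {i : ℤ} (hi0 : i < 0)
    (hi : todo m f i < m + i) : todo m f (i + 1) ≤ todo m f i + 1 := by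
  by_contra hc
  have him : -m < i := by have := h.todo_nonneg i; omega
  have key : ∀ k : ℕ, -m ≤ i - k → todo m f (i - k) < m + (i - k) ∧
      ∀ j, i - k ≤ j → j ≤ i → 1 ≤ f j := by
    intro k
    induction k with
    | zero =>
      intro _
      refine ⟨by simpa using hi, fun j h1 h2 => ?_⟩
      have : j = i := by push_cast at h1; omega
      subst this
      exact fired_of_todo_lt (m := m) (by rw [abs_of_neg hi0]; omega)
    | succ k ih =>
      intro hk
      push_cast at hk ⊢
      obtain ⟨h1, h2⟩ := ih (by omega)
      have s := h.seg (i - k) i (by omega) h2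
      rw [if_neg (by omega)] at s
      have e1 := finalOdo_left (m := m) (i := i) (by omega) (by omega)
      have e2 := finalOdo_left (m := m) (i := i + 1) (by omega) (by omega)
      have e3 := finalOdo_left (m := m) (i := i - k) (by omega) (by omega)
      have e4 := finalOdo_left (m := m) (i := i - k - 1) (by omega) (by omega)
      have lt : todo m f (i - (k + 1)) < m + (i - (k + 1)) := by
        rw [show i - ((k : ℤ) + 1) = i - k - 1 by ring]
        unfold todo at *
        rw [e1, e2] at hc
        rw [e3] at h1
        rw [e4]
        nlinarith
      refine ⟨lt, fun j hj1 hj2 => ?_⟩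
      rcases eq_or_lt_of_le hj1 with hj | hj
      · subst hj
        exact fired_of_todo_lt (m := m) (by rw [abs_of_neg (by omega)]; omega)
      · exact h2 j (by omega) hj2
  have := (key (m + i).toNat (by omega)).1
  have := h.todo_nonneg (i - (m + i).toNat)
  omega

/-- Near the end, an outer neighbor has no more firings to come. -/
lemma Good.todo_outer_le (h : Good m f) {x : ℤ} (hx0 : x ≤ 0)
    (hx : todo m f x < m + x) : todo m f (x - 1) ≤ todo m f x := by
  by_contra hc
  have hxm : -m < x := by have := h.todo_nonneg x; omega
  have key : ∀ k : ℕ, x + k ≤ m → todo m f (x + k) < m + x - max (x + k) 0 ∧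
      ∀ j, x ≤ j → j ≤ x + k → 1 ≤ f j := by
    intro k
    induction k with
    | zero =>
      intro _
      refine ⟨by simpa [hx0] using hx, fun j h1 h2 => ?_⟩
      have : j = x := by push_cast at h2; omega
      subst this
      exact fired_of_todo_lt (m := m) (by rw [abs_of_nonpos hx0]; omega)
    | succ k ih =>
      intro hk
      push_cast at hk ⊢
      obtain ⟨h1, h2⟩ := ih (by omega)
      have s := h.seg x (x + k) (by omega) h2
      have e1 := finalOdo_left (m := m) (i := x) (by omega) (by omega)
      have e2 := finalOdo_left (m := m) (i := x - 1) (by omega) (by omega)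
      have lt : todo m f (x + (k + 1)) < m + x - max (x + (k + 1)) 0 := by
        rw [show x + ((k : ℤ) + 1) = x + k + 1 by ring]
        rcases lt_or_ge (x + k) 0 with hk0 | hk0
        · rw [if_neg (by omega)] at s
          have e3 := finalOdo_left (m := m) (i := x + k) (by omega) (by omega)
          have e4 := finalOdo_left (m := m) (i := x + k + 1) (by omega) (by omega)
          rw [max_eq_right (by omega)] at h1 ⊢
          unfold todo at *
          rw [e1, e2] at hc
          rw [e3] at h1
          rw [e4]
          nlinarith
        · rw [if_pos (by omega)] at s
          have e3 := finalOdo_right (m := m) (i := x + k) (by omega) (by omega)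
          have e4 := finalOdo_right (m := m) (i := x + k + 1) (by omega) (by omega)
          rw [max_eq_left (by omega)] at h1 ⊢
          unfold todo at *
          rw [e1, e2] at hc
          rw [e3] at h1
          rw [e4]
          nlinarith
      refine ⟨lt, fun j hj1 hj2 => ?_⟩
      rcases eq_or_lt_of_le hj2 with hj | hj
      · subst hj
        refine fired_of_todo_lt (m := m) ?_
        rcases le_total (x + ((k : ℤ) + 1)) 0 with hk0 | hk0
        · rw [abs_of_nonpos hk0]; omega
        · rw [abs_of_nonneg hk0]; omega
      · exact h2 j hj1 (by omega)
  have := (key (m - x).toNat (by omega)).1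
  have := h.todo_nonneg (x + (m - x).toNat)
  omega

lemma Good.le_todo_inner (h : Good m f) {i : ℤ} (hi0 : i < 0) (hi : todo m f i ≤ m + i) :
    todo m f i ≤ todo m f (i + 1) := by
  by_contra hc
  have := h.todo_outer_le (x := i + 1) (by omega) (by omega)
  rw [show i + 1 - 1 = i by ring] at this
  omega

lemma Good.le_todo_outer (h : Good m f) {i : ℤ} (hi0 : i ≤ 0) (hi : todo m f i ≤ m + i) :
    todo m f i ≤ todo m f (i - 1) + 1 := by
  by_contra hc
  have := h.todo_inner_le (i := i - 1) (by omega) (by omega)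
  rw [show i - 1 + 1 = i by ring] at this
  omega

/-- When y has just entered the final regime, no site further out is past its own entry; this bounds
the odometer there from above. -/
lemma Good.le_todo_of_le (h : Good m f) {y : ℤ} (hy0 : y ≤ 0) (hy : todo m f y = m + y) (k : ℕ) :
    m + (y - k) ≤ todo m f (y - k) := by
  induction k with
  | zero => simp [hy]
  | succ k ih =>
    by_contra hc
    push_cast at hc
    have := h.todo_inner_le (i := y - (k + 1)) (by omega) (by omega)
    rw [show y - ((k : ℤ) + 1) + 1 = y - k by ring] at this
    omega

lemma todo_reflect (i : ℤ) : todo m (fun j => f (-j)) i = todo m f (-i) := by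
  simp [todo, finalOdo_neg]

lemma Good.todo_inner_le' (h : Good m f) {i : ℤ} (hi0 : 0 < i)
    (hi : todo m f i < m - i) : todo m f (i - 1) ≤ todo m f i + 1 := by
  have := h.reflect.todo_inner_le (i := -i) (by omega) (by rw [todo_reflect, neg_neg]; omega)
  rwa [todo_reflect, todo_reflect, neg_neg, show -(-i + 1) = i - 1 by ring] at this

lemma Good.le_todo_inner' (h : Good m f) {i : ℤ} (hi0 : 0 < i) (hi : todo m f i ≤ m - i) :
    todo m f i ≤ todo m f (i - 1) := by
  have := h.reflect.le_todo_inner (i := -i) (by omega) (by rw [todo_reflect, neg_neg]; omega)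
  rwa [todo_reflect, todo_reflect, neg_neg, show -(-i + 1) = i - 1 by ring] at this

lemma Good.le_todo_of_le' (h : Good m f) {y : ℤ} (hy0 : 0 ≤ y) (hy : todo m f y = m - y) (k : ℕ) :
    m - (y + k) ≤ todo m f (y + k) := by
  have := h.reflect.le_todo_of_le (y := -y) (by omega) (by rw [todo_reflect, neg_neg]; omega) k
  rw [todo_reflect, show -(-y - (k : ℤ)) = y + k by ring] at this
  omega

lemma todo_update_self (z : ℤ) :
    todo m (Function.update f z (f z + 1)) z = todo m f z - 1 := by
  simp [todo]; ring

lemma todo_update_of_ne {z i : ℤ} (hi : i ≠ z) :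
    todo m (Function.update f z (f z + 1)) i = todo m f i := by
  simp [todo, hi]

/-- Near the end, a site left of or at the origin fires only just before its outer neighbor. -/
lemma Good.todo_at_step (hm : 1 ≤ m) (h : Good m f) {z : ℤ} (hz : 3 ≤ load m f z)
    (hz0 : z ≤ 0) (ha : todo m f z ≤ m + z) :
    todo m f (z - 1) = todo m f z - 1 ∧ (z < 0 → todo m f (z + 1) = todo m f z) := by
  have h' := h.step hm hz
  have e1 := h.le_todo_outer hz0 ha
  have e2 := h'.todo_outer_le hz0 (by rw [todo_update_self]; omega)
  rw [todo_update_self, todo_update_of_ne (by omega)] at e2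
  refine ⟨by omega, fun hlt => ?_⟩
  have e3 := h.le_todo_inner hlt ha
  have e4 := h'.todo_inner_le hlt (by rw [todo_update_self]; omega)
  rw [todo_update_self, todo_update_of_ne (by omega)] at e4
  omega

lemma load_reflect (z : ℤ) : load m (fun j => f (-j)) z = load m f (-z) := by
  rw [load_eq, load_eq, show -(z - 1) = -z + 1 by ring, show -(z + 1) = -z - 1 by ring]
  have : (if z = 0 then 4 * m - 1 else 0) = if -z = 0 then 4 * m - 1 else 0 :=
    if_congr (by omega) rfl rfl
  rw [this]; ring

lemma Good.todo_at_step' (hm : 1 ≤ m) (h : Good m f) {z : ℤ} (hz : 3 ≤ load m f z)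
    (hz0 : 0 ≤ z) (ha : todo m f z ≤ m - z) :
    todo m f (z + 1) = todo m f z - 1 ∧ (0 < z → todo m f (z - 1) = todo m f z) := by
  have := h.reflect.todo_at_step hm (z := -z) (by rwa [load_reflect, neg_neg]) (by omega)
    (by rw [todo_reflect, neg_neg]; omega)
  rw [todo_reflect, todo_reflect, todo_reflect, neg_neg, show -(-z - 1) = z + 1 by ring,
    show -(-z + 1) = z - 1 by ring] at this
  exact ⟨this.1, fun hp => this.2 (by omega)⟩

lemma load_left {i : ℤ} (h1 : -m < i) (h2 : i < 0) :
    load m f i = 2 + 2 * todo m f i - todo m f (i - 1) - todo m f (i + 1) := by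
  have e1 := finalOdo_left (m := m) (i := i) (by omega) (by omega)
  have e2 := finalOdo_left (m := m) (i := i - 1) (by omega) (by omega)
  have e3 := finalOdo_left (m := m) (i := i + 1) (by omega) (by omega)
  rw [load_eq, if_neg (by omega)]
  unfold todo
  rw [e1, e2, e3]; ring

lemma load_right {i : ℤ} (h1 : i < m) (h2 : 0 < i) :
    load m f i = 2 + 2 * todo m f i - todo m f (i - 1) - todo m f (i + 1) := by
  have := load_left (m := m) (f := fun j => f (-j)) (i := -i) (by omega) (by omega)
  rw [load_reflect, todo_reflect, todo_reflect, todo_reflect, neg_neg,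
    show -(-i - 1) = i + 1 by ring, show -(-i + 1) = i - 1 by ring] at this
  omega

lemma load_zero (hm : 1 ≤ m) :
    load m f 0 = 1 + 2 * todo m f 0 - todo m f (-1) - todo m f 1 := by
  have e1 := finalOdo_left (m := m) (i := 0) (by omega) (by omega)
  have e2 := finalOdo_left (m := m) (i := -1) (by omega) (by omega)
  have e3 := finalOdo_right (m := m) (i := 1) (by omega) (by omega)
  rw [load_eq, if_pos rfl]
  unfold todo
  rw [e1, e2, e3, show (0:ℤ) - 1 = -1 by ring, show (0:ℤ) + 1 = 1 by ring]; ring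

lemma Good.load_eq_zero (h : Good m f) {i : ℤ} (hi : m < |i|) (hm : 1 ≤ m) : load m f i = 0 := by
  have z : ∀ j, m ≤ |j| → f j = 0 := fun j hj => by
    have := h.le j; have := h.nonneg j; have := finalOdo_of_le hj; omega
  rw [load_eq, z i (by omega), if_neg (by rintro rfl; simp at hi; omega)]
  rcases abs_cases i with hc | hc
  · rw [z (i - 1) (le_trans (by omega) (le_abs_self _)),
      z (i + 1) (le_trans (by omega) (le_abs_self _))]; rfl
  · rw [z (i - 1) (le_trans (by omega) (neg_le_abs _)),
      z (i + 1) (le_trans (by omega) (neg_le_abs _))]; rfl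

lemma Good.load_boundary (h : Good m f) {i : ℤ} (hi : |i| = m) (hm : 1 ≤ m) : load m f i ≤ 1 := by
  have z : ∀ j, m ≤ |j| → f j = 0 := fun j hj => by
    have := h.le j; have := h.nonneg j; have := finalOdo_of_le hj; omega
  rw [load_eq, z i (by omega), if_neg (by rintro rfl; simp at hi; omega)]
  rcases abs_cases i with hc | hc
  · rw [z (i + 1) (le_trans (by omega) (le_abs_self _))]
    have := h.le (i - 1)
    rw [finalOdo_right (by omega) (by omega), show m - (i - 1) = 1 by omega] at this
    omega
  · rw [z (i - 1) (le_trans (by omega) (neg_le_abs _))]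
    have := h.le (i + 1)
    rw [finalOdo_left (by omega) (by omega), show m + (i + 1) = 1 by omega] at this
    omega

lemma Good.abs_lt_of_load (h : Good m f) {i : ℤ} (hm : 1 ≤ m) (hi : 2 ≤ load m f i) : |i| < m := by
  by_contra hc
  rcases eq_or_lt_of_le (not_lt.mp hc) with h1 | h1
  · have := h.load_boundary h1.symm hm; omega
  · have := h.load_eq_zero h1 hm; omega

/-- Near the end, a site fires only when it carries exactly three chips. -/
lemma Good.load_at_step (hm : 1 ≤ m) (h : Good m f) {z : ℤ} (hz : 3 ≤ load m f z)
    (ha : todo m f z ≤ m - |z|) : load m f z = 3 := by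
  have hzm := abs_lt.mp (h.abs_lt_of_load hm (by omega : 2 ≤ load m f z))
  rcases lt_trichotomy z 0 with h0 | h0 | h0
  · rw [abs_of_neg h0] at ha
    have := h.todo_at_step hm hz h0.le (by omega)
    have := this.2 h0
    rw [load_left (by omega) h0]; omega
  · subst h0
    simp only [abs_zero, sub_zero] at ha
    have h1 := (h.todo_at_step hm hz le_rfl (by omega)).1
    have h2 := (h.todo_at_step' hm hz le_rfl (by omega)).1
    simp only [zero_sub, zero_add] at h1 h2
    rw [load_zero hm]; omega
  · rw [abs_of_pos h0] at ha
    have := h.todo_at_step' hm hz h0.le (by omega)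
    have := this.2 h0
    rw [load_right (by omega) h0]; omega

/-- A stable state has no firings to come. -/
lemma Good.todo_eq_zero (hm : 1 ≤ m) (h : Good m f) (hs : ∀ i, load m f i ≤ 2) (i : ℤ) :
    todo m f i = 0 := by
  have left : ∀ g : ℤ → ℤ, Good m g → (∀ i, load m g i ≤ 2) →
      ∀ k : ℕ, k < m → todo m g (-m + k) ≤ todo m g (-m + k + 1) := by
    intro g hg hs k
    induction k with
    | zero =>
      intro _
      have := hg.todo_of_le (i := -m) (neg_le_abs _ |>.trans' (by omega))
      have := hg.todo_nonneg (-m + 1)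
      simp; omega
    | succ k ih =>
      intro hk
      push_cast at hk ⊢
      have := ih (by omega)
      have h2 := hs (-m + (k + 1))
      rw [load_left (by omega) (by omega), show -m + ((k : ℤ) + 1) - 1 = -m + k by ring] at h2
      rw [show -m + (k : ℤ) + 1 = -m + (k + 1) by ring] at this
      omega
  have mono : ∀ g : ℤ → ℤ, Good m g → (∀ i, load m g i ≤ 2) →
      ∀ k : ℕ, k ≤ m → todo m g (-k) ≤ todo m g 0 := by
    intro g hg hs k
    induction k with
    | zero => intro _; simp
    | succ k ih =>
      intro hk
      push_cast at hk ⊢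
      have h1 := left g hg hs (m - 1 - k).toNat (by omega)
      rw [show -m + ((m - 1 - k).toNat : ℤ) = -(k + 1) by omega,
        show -((k : ℤ) + 1) + 1 = -k by ring] at h1
      exact h1.trans (ih (by omega))
  have flat : ∀ g : ℤ → ℤ, Good m g → (∀ i, load m g i ≤ 2) →
      todo m g 0 ≤ todo m g (-1) → todo m g 0 = 0 := by
    intro g hg hs h0
    have key : ∀ k : ℕ, k < m → todo m g (-k) ≤ todo m g (-(k + 1)) ∧
        todo m g 0 ≤ todo m g (-(k + 1)) := by
      intro k
      induction k with
      | zero => intro _; simpa using h0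
      | succ k ih =>
        intro hk
        push_cast at hk ⊢
        obtain ⟨e1, e2⟩ := ih (by omega)
        have h2 := hs (-(k + 1))
        rw [load_left (by omega) (by omega), show -((k : ℤ) + 1) - 1 = -(k + 1 + 1) by ring,
          show -((k : ℤ) + 1) + 1 = -k by ring] at h2
        omega
    have h1 := (key (m - 1).toNat (by omega)).2
    rw [show -(((m - 1).toNat : ℤ) + 1) = -m by omega,
      hg.todo_of_le (i := -m) (neg_le_abs _ |>.trans' (by omega))] at h1
    have := hg.todo_nonneg 0
    omega
  have hr : ∀ i, load m (fun j => f (-j)) i ≤ 2 := fun i => by rw [load_reflect]; exact hs _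
  have h0 : todo m f 0 = 0 := by
    have h1 := hs 0
    rw [load_zero hm] at h1
    by_cases hc : todo m f 0 ≤ todo m f (-1)
    · exact flat f h hs hc
    · have := flat _ h.reflect hr (by simp only [todo_reflect]; simp; omega)
      simpa [todo_reflect] using this
  have hi := h.todo_nonneg i
  rcases le_or_gt m |i| with hm' | hm'
  · exact h.todo_of_le hm'
  rcases le_total i 0 with hi0 | hi0
  · rw [abs_of_nonpos hi0] at hm'
    have := mono f h hs (-i).toNat (by omega)
    rw [show -(((-i).toNat : ℤ)) = i by omega] at this
    omega
  · rw [abs_of_nonneg hi0] at hm'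
    have := mono _ h.reflect hr i.toNat (by omega)
    simp only [todo_reflect] at this
    rw [show - -((i.toNat : ℤ)) = i by omega] at this
    simp at this
    omega

end chains
end LabeledChipFiring

/-! ### Small and large chips firing in triples -/

namespace LabeledChipFiring

/-- An upper bound for the total distance by which `2 * t` chips started at the origin can exceed
the site `i` in the unlabeled process. -/
def reachBound (t i : ℤ) : ℤ := max 0 (t - 2 * i) ^ 2 / 4

lemma reachBound_add (t i : ℤ) (h : 0 ≤ t - 2 * i) :
    reachBound t (i - 1) = reachBound t i + (t - 2 * i) + 1 := by
  unfold reachBound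
  rw [max_eq_right h, max_eq_right (by omega),
    show (t - 2 * (i - 1)) ^ 2 = (t - 2 * i) ^ 2 + ((t - 2 * i) + 1) * 4 by ring,
    Int.add_mul_ediv_right _ _ (by norm_num)]
  ring

lemma reachBound_eq_zero {t i : ℤ} (h : t - 2 * i ≤ 1) : reachBound t i = 0 := by
  unfold reachBound
  rcases le_or_gt (t - 2 * i) 0 with h0 | h0
  · rw [max_eq_left h0]; norm_num
  · rw [show t - 2 * i = 1 by omega]; norm_num

lemma reachBound_nonneg (t i : ℤ) : 0 ≤ reachBound t i :=
  Int.ediv_nonneg (sq_nonneg _) (by norm_num)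

lemma reachBound_laplacian (t i : ℤ) :
    reachBound t (i - 1) + reachBound t (i + 1) ≤ 2 * reachBound t i + 2 := by
  rcases lt_or_ge (t - 2 * i) 0 with h | h
  · have := reachBound_nonneg t i
    rw [reachBound_eq_zero (i := i - 1) (by omega), reachBound_eq_zero (i := i + 1) (by omega)]
    omega
  · have h1 := reachBound_add t i h
    rcases lt_or_ge (t - 2 * i) 2 with h2 | h2
    · rw [reachBound_eq_zero (i := i + 1) (by omega)]
      rw [reachBound_eq_zero (i := i) (by omega)] at h1 ⊢
      omega
    · have h3 := reachBound_add t (i + 1) (by omega)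
      rw [show i + 1 - 1 = i by ring] at h3
      omega

lemma le_reachBound {t i k : ℤ} (h : i ≤ 0) (hk : k ≤ 2 * t) : k * (-i) ≤ reachBound t i := by
  unfold reachBound
  rw [Int.le_ediv_iff_mul_le (by norm_num)]
  have h1 : (t - 2 * i) * (t - 2 * i) ≥ 8 * t * (-i) := by nlinarith [sq_nonneg (t + 2 * i)]
  have h2 : k * -i * 4 ≤ 8 * t * (-i) := by nlinarith
  rcases le_total 0 (t - 2 * i) with h3 | h3
  · rw [max_eq_right h3]; nlinarith
  · have : 8 * t * (-i) ≤ 0 := by nlinarith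
    nlinarith [sq_nonneg (max 0 (t - 2 * i))]

/-- ⌊q²/4⌋ is the product of the two halves of q; W = ⌈q/2⌉ will serve as the width of an interval.
-/
lemma reachBound_eq {t i q : ℤ} (hq : q = t - 2 * i) (h : 0 ≤ q) :
    reachBound t i = (q + 1) / 2 * (q - (q + 1) / 2) := by
  unfold reachBound
  rw [← hq, max_eq_right h]
  rcases Int.even_or_odd' q with ⟨j, hj | hj⟩
  · rw [show (q + 1) / 2 = j by omega, hj, show (2 * j) ^ 2 = j * j * 4 by ring,
      Int.mul_ediv_cancel _ (by norm_num)]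
    ring
  · rw [show (q + 1) / 2 = j + 1 by omega, hj,
      show (2 * j + 1) ^ 2 = 1 + (j * j + j) * 4 by ring, Int.add_mul_ediv_right _ _ (by norm_num)]
    norm_num
    ring

/-- A firing move in the process in which `4 * m - 1` chips, some of them small and the others
large, fire in triples: `f` is the odometer, and `n y` counts the small chips at or to the right
of `y`. -/
def UnitStep (m : ℤ) (f n f' n' : ℤ → ℤ) : Prop :=
  -- L and R count the small chips sent left and right. The cases are three large chips, a small
  -- chip left with a large one right, and three small chips; the middle case asks nothing of the
  -- site's composition.
  ∃ z L R : ℤ, 3 ≤ load m f z ∧ f' = Function.update f z (f z + 1) ∧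
    (∀ y, n' y = n y - (if y = z then L else 0) + (if y = z + 1 then R else 0)) ∧
    ((L = 0 ∧ R = 0 ∧ n z - n (z + 1) + 3 ≤ load m f z) ∨ (L = 1 ∧ R = 0) ∨
      (L = 1 ∧ R = 1 ∧ 3 ≤ n z - n (z + 1)))

/-- The numbers of small and of large chips at a site are not negative. -/
structure Valid (m : ℤ) (f n : ℤ → ℤ) : Prop where
  anti : ∀ y, n (y + 1) ≤ n y
  le : ∀ y, n y - n (y + 1) ≤ load m f y

/-- Bounds on the spread of `2 * t - 1` small and `4 * m - 2 * t` large chips. -/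
structure Spread (m t : ℤ) (f n : ℤ → ℤ) : Prop where
  left : ∀ y ≤ -m, n y = 2 * t - 1
  -- `H i` sums the distances of the small chips beyond i on the right; `G i` below does so for the
  -- large chips on the left.
  small : ∃ H : ℤ → ℤ, (∀ i, H (i - 1) = H i + n i) ∧ (∀ i, m ≤ i → H i = 0) ∧
    ∀ i, H i ≤ reachBound t i
  large : ∃ G : ℤ → ℤ, (∀ i, G (i + 1) = G i + (4 * m - 2 * t - tail m f (i + 1) + n (i + 1))) ∧
    (∀ i ≤ -m, G i = 0) ∧ ∀ i, G i ≤ reachBound (2 * m - t) (-i)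

/-- The number of small chips at or to the right of `y` that is allowed when `a` firings at `y` are
still to come. -/
def endBound (m t y a : ℤ) : ℤ :=
  -- Each remaining firing at y brings at most one small chip to its left, and in the end each site
  -- from y to t-m-1 has room for two. Both branches give a at y = t-m.
  if y ≤ t - m then a + 2 * (t - m - y) else max 0 (a + t - m - min y 0)

/-- Near the end, the small chips to the right of `y` can still get to the left of `y`. -/
def EndBounded (m t : ℤ) (f n : ℤ → ℤ) : Prop :=
  ∀ y, |y| ≤ m → todo m f y ≤ m - |y| → n y ≤ endBound m t y (todo m f y)

variable {m t : ℤ} {f n f' n' : ℤ → ℤ}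

lemma tail_update (z y : ℤ) : tail m (Function.update f z (f z + 1)) y =
    tail m f y - (if y = z then 1 else 0) + (if y = z + 1 then 1 else 0) := by
  unfold tail
  by_cases h1 : y = z
  · subst h1
    rw [Function.update_self, Function.update_of_ne (by omega), if_pos rfl,
      if_neg (show ¬ y = y + 1 by omega)]
    ring
  · by_cases h2 : y = z + 1
    · subst h2
      rw [show z + 1 - 1 = z by ring, Function.update_self, Function.update_of_ne (by omega),
        if_neg (show ¬ z + 1 = z by omega), if_pos rfl]
      ring
    · rw [Function.update_of_ne h1, Function.update_of_ne (by omega), if_neg h1, if_neg h2]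
      ring

lemma spread_zero (hm : 1 ≤ m) :
    Spread m t (fun _ => 0) (fun y => if y ≤ 0 then 2 * t - 1 else 0) where
  left y hy := by rw [if_pos (by omega)]
  small := by
    refine ⟨fun i => (2 * t - 1) * max 0 (-i), fun i => ?_, fun i hi => ?_, fun i => ?_⟩
    · simp only
      split_ifs with h
      · rw [max_eq_right (by omega), max_eq_right (by omega)]; ring
      · rw [max_eq_left (by omega), max_eq_left (by omega)]; ring
    · simp only
      rw [max_eq_left (by omega)]; ring
    · simp only
      rcases le_total 0 i with h | h
      · rw [max_eq_left (by omega), mul_zero]; exact reachBound_nonneg _ _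
      · rw [max_eq_right (by omega)]; exact le_reachBound h (by omega)
  large := by
    refine ⟨fun i => (4 * m - 2 * t) * max 0 i, fun i => ?_, fun i hi => ?_, fun i => ?_⟩
    · simp only [tail]
      split_ifs with h
      · rw [max_eq_left (by omega), max_eq_left (by omega)]; ring
      · rw [max_eq_right (by omega), max_eq_right (by omega)]; ring
    · simp only
      rw [max_eq_left (by omega)]; ring
    · simp only
      rcases le_total i 0 with h | h
      · rw [max_eq_left (by omega), mul_zero]; exact reachBound_nonneg _ _
      · rw [max_eq_right (by omega)]
        have := le_reachBound (t := 2 * m - t) (i := -i) (k := 4 * m - 2 * t) (by omega) (by omega)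
        rwa [neg_neg] at this

/-- The second difference of `H` at i is the number of small chips there. A move that raises `H i`
needs three of them, while `reachBound` has second difference at most 2, so `H i` was strictly below
its bound. The same holds for `G` and large chips. -/
lemma Spread.step (hm : 1 ≤ m) (hg : Good m f) (h : Spread m t f n)
    (hs : UnitStep m f n f' n') : Spread m t f' n' := by
  obtain ⟨z, L, R, hz, rfl, hn, hLR⟩ := hs
  have hzm := abs_lt.mp (hg.abs_lt_of_load hm (by omega : 2 ≤ load m f z))
  refine ⟨fun y hy => ?_, ?_, ?_⟩
  · rw [hn, if_neg (by omega), if_neg (by omega), h.left y hy]; ring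
  · obtain ⟨H, h1, h2, h3⟩ := h.small
    refine ⟨fun i => H i + (if i = z then R else 0) + (if i < z then R - L else 0),
      fun i => ?_, fun i hi => ?_, fun i => ?_⟩
    · simp only [h1, hn]
      split_ifs <;> omega
    · simp only [h2 i hi]
      rw [if_neg (by omega), if_neg (by omega)]; ring
    · simp only
      have a1 := h3 i
      by_cases hi : i = z
      · subst hi
        rw [if_pos rfl, if_neg (by omega)]
        have a2 := h3 (i - 1)
        have a3 := h3 (i + 1)
        have a4 := h1 i
        have a5 := h1 (i + 1)
        rw [show i + 1 - 1 = i by ring] at a5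
        have a6 := reachBound_laplacian t i
        omega
      · rw [if_neg hi]
        split_ifs <;> omega
  · obtain ⟨G, h1, h2, h3⟩ := h.large
    refine ⟨fun i => G i + (if i = z then 1 - L else 0) + (if z < i then R - L else 0),
      fun i => ?_, fun i hi => ?_, fun i => ?_⟩
    · simp only [h1, hn, tail_update]
      split_ifs <;> omega
    · simp only [h2 i hi]
      rw [if_neg (by omega), if_neg (by omega)]; ring
    · simp only
      have a1 := h3 i
      by_cases hi : i = z
      · subst hi
        rw [if_pos rfl, if_neg (by omega)]
        have a2 := h3 (i - 1)
        have a3 := h3 (i + 1)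
        have a4 := h1 i
        have a5 := h1 (i - 1)
        rw [show i - 1 + 1 = i by ring] at a5
        have a6 := reachBound_laplacian (2 * m - t) (-i)
        rw [show -i - 1 = -(i + 1) by ring, show -i + 1 = -(i - 1) by ring] at a6
        unfold load at hLR
        omega
      · rw [if_neg hi]
        split_ifs <;> omega

lemma Valid.antitone (h : Valid m f n) (y : ℤ) (k : ℕ) : n (y + k) ≤ n y := by
  induction k with
  | zero => simp
  | succ k ih =>
    push_cast
    rw [← add_assoc]
    exact (h.anti _).trans ih

lemma Valid.small_nonneg (h : Valid m f n) (hs : Spread m t f n)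
    (y : ℤ) : 0 ≤ n y := by
  obtain ⟨H, h1, h2, -⟩ := hs.small
  have h3 : n (max y (m + 1)) = 0 := by
    have := h1 (max y (m + 1))
    rw [h2 _ (by omega), h2 _ (by omega)] at this
    omega
  have := h.antitone y (max y (m + 1) - y).toNat
  rw [show y + ((max y (m + 1) - y).toNat : ℤ) = max y (m + 1) by omega] at this
  omega

lemma Valid.large_tail (h : Valid m f n) (y : ℤ) (k : ℕ) :
    n y - n (y + k) ≤ tail m f y - tail m f (y + k) := by
  induction k with
  | zero => simp
  | succ k ih =>
    have := h.le (y + k)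
    unfold load at this
    push_cast
    rw [← add_assoc]
    omega

lemma Valid.large_nonneg (hm : 1 ≤ m) (h : Valid m f n) (hg : Good m f)
    (hs : Spread m t f n) (y : ℤ) : 0 ≤ 4 * m - 2 * t - tail m f y + n y := by
  have z : ∀ j, m ≤ |j| → f j = 0 := fun j hj => by
    have := hg.le j; have := hg.nonneg j; have := finalOdo_of_le hj; omega
  have h1 := h.large_tail (min y (-m)) (y - min y (-m)).toNat
  rw [show min y (-m) + ((y - min y (-m)).toNat : ℤ) = y by omega, hs.left _ (by omega)] at h1
  have h2 : tail m f (min y (-m)) = 4 * m - 1 := by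
    unfold tail
    rw [if_pos (by omega), z _ (le_trans (by omega) (neg_le_abs _)),
      z _ (le_trans (by omega) (neg_le_abs _))]
    ring
  omega

/-- The odometer tells how many chips lie to the left. With more than t small chips at or right of
y, too many of those on the left are large, and `G y` exceeds its bound. -/
lemma Spread.le_left (hm : 1 ≤ m) (ht : 1 ≤ t) (hg : Good m f) (hv : Valid m f n)
    (h : Spread m t f n) {y : ℤ} (hy : -m ≤ y) (hy0 : y ≤ 0) (ha : todo m f y = m + y)
    (hq : t < 2 * (m + y)) : n y ≤ t := by
  obtain ⟨G, h1, h2, h3⟩ := h.large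
  have hB : ∀ i, G i ≤ G (i + 1) := fun i => by
    have := hv.large_nonneg hm hg h (i + 1); have := h1 i; omega
  have hG : ∀ k : ℕ, 0 ≤ G (-m + k) := by
    intro k
    induction k with
    | zero => simp [h2]
    | succ k ih => have := hB (-m + k); push_cast; rw [← add_assoc]; omega
  have key : ∀ k : ℕ, -m ≤ y - k → G y - G (y - k) ≥ k * (n y - 2 * t + 1) + f y - f (y - k) := by
    intro k
    induction k with
    | zero => simp
    | succ k ih =>
      intro hk
      push_cast at hk ⊢
      have i1 := ih (by omega)
      have i2 := h1 (y - (k + 1))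
      rw [show y - ((k : ℤ) + 1) + 1 = y - k by ring] at i2
      have i3 := hv.antitone (y - k) k
      rw [sub_add_cancel] at i3
      unfold tail at i2
      rw [if_pos (by omega), show y - (k : ℤ) - 1 = y - (k + 1) by ring] at i2
      linarith
  by_contra hc
  -- With q = 2(m+y)-t and W = ⌈q/2⌉, the W sites up to y force `G y` to be at least W(q-W)+W, while
  -- the bound is W(q-W).
  obtain ⟨W, hW⟩ : ∃ W : ℕ, (W : ℤ) = (2 * (m + y) - t + 1) / 2 :=
    ⟨((2 * (m + y) - t + 1) / 2).toNat, by omega⟩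
  have k1 := key W (by omega)
  have k2 := hG (y - W + m).toNat
  rw [show -m + ((y - W + m).toNat : ℤ) = y - W by omega] at k2
  have k3 := hg.le_todo_of_le hy0 ha W
  unfold todo at k3 ha
  rw [finalOdo_left (by omega) (by omega)] at k3 ha
  have k4 := reachBound_eq (t := 2 * m - t) (i := -y) rfl (by omega)
  rw [show 2 * m - t - 2 * -y = 2 * (m + y) - t by ring, ← hW] at k4
  have k5 := h3 y
  have k6 : (W : ℤ) * (2 * (m + y) - t - W) + W ≤ W * (n y - 2 * t + 1) + f y - f (y - W) := by
    have : 0 ≤ (W : ℤ) * (n y - (t + 1)) := mul_nonneg (by omega) (by omega)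
    nlinarith
  omega

/-- Small chips are lost from the tail at y+k no faster than chips altogether, so a large `n y`
forces a large `H (y - 1)`. -/
lemma Spread.le_right (hm : 1 ≤ m) (htm : t ≤ m) (hg : Good m f) (hv : Valid m f n)
    (h : Spread m t f n) {y : ℤ} (hy : y ≤ m) (hy0 : 0 < y) (ha : todo m f y = m - y) :
    n y ≤ max 0 (t - y) := by
  obtain ⟨H, h1, h2, h3⟩ := h.small
  have hH : ∀ k : ℕ, 0 ≤ H (m - k) := by
    intro k
    induction k with
    | zero => simp [h2]
    | succ k ih =>
      have := h1 (m - k)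
      have := hv.small_nonneg h (m - k)
      push_cast; rw [← sub_sub]; omega
  by_contra hc
  have key : ∀ k : ℕ, H (y - 1) - H (y - 1 + k) ≥
      k * (n y - f (y - 1) + f y) + f (y - 1) - f (y - 1 + k) := by
    intro k
    induction k with
    | zero => simp
    | succ k ih =>
      push_cast
      have i2 := h1 (y + k)
      have i3 := hv.large_tail y k
      unfold tail at i3
      rw [if_neg (by omega), if_neg (by omega)] at i3
      rw [show y + (k : ℤ) - 1 = y - 1 + k by ring] at i2 i3
      rw [show y - 1 + ((k : ℤ) + 1) = y + k by ring]
      linarith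
  rcases le_or_gt (t - 2 * (y - 1)) 0 with hq | hq
  · have i1 := h3 (y - 1)
    rw [reachBound_eq_zero (by omega)] at i1
    have i2 := h1 y
    have i3 := hH (m - y).toNat
    rw [show m - ((m - y).toNat : ℤ) = y by omega] at i3
    omega
  obtain ⟨W, hW⟩ : ∃ W : ℕ, (W : ℤ) = (t - 2 * (y - 1) + 1) / 2 :=
    ⟨((t - 2 * (y - 1) + 1) / 2).toNat, by omega⟩
  have k1 := key W
  have k2 := hH (m - (y - 1 + W)).toNat
  rw [show m - ((m - (y - 1 + W)).toNat : ℤ) = y - 1 + W by omega] at k2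
  have k3 := hg.le_todo_of_le' hy0.le ha (W - 1)
  rw [show y + ((W - 1 : ℕ) : ℤ) = y - 1 + W by omega] at k3
  have k4 := reachBound_eq (t := t) (i := y - 1) rfl (by omega)
  rw [← hW] at k4
  have k5 := h3 (y - 1)
  have k7 := hg.le_todo_inner' hy0 ha.le
  unfold todo at k3 ha k7
  rw [finalOdo_right (by omega) (by omega)] at k3 ha
  rw [finalOdo_right (by omega) (by omega), finalOdo_right (by omega) (by omega)] at k7
  have k6 : (W : ℤ) * (t - 2 * (y - 1) - W) + 1 ≤
      W * (n y - f (y - 1) + f y) + f (y - 1) - f (y - 1 + W) := by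
    have a1 : 0 ≤ (W : ℤ) * (n y - (t - 2 * y + 2)) := mul_nonneg (by omega) (by omega)
    have a2 : 0 ≤ ((W : ℤ) - 1) * ((m - (y - 1)) ^ 2 - f (y - 1) - (m - y) ^ 2 + f y) :=
      mul_nonneg (by omega) (by linarith)
    nlinarith
  omega

end LabeledChipFiring

namespace LabeledChipFiring
variable {m t : ℤ} {f n f' n' : ℤ → ℤ}

lemma Spread.endBound_of_eq (hm : 1 ≤ m) (ht : 1 ≤ t) (htm : t ≤ m) (hg : Good m f)
    (hv : Valid m f n) (h : Spread m t f n) {y : ℤ} (hy : |y| ≤ m) (ha : todo m f y = m - |y|) :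
    n y ≤ endBound m t y (todo m f y) := by
  obtain ⟨y1, y2⟩ := abs_le.mp hy
  unfold endBound
  rcases le_or_gt y 0 with hy0 | hy0
  · rw [abs_of_nonpos hy0] at ha
    rcases eq_or_lt_of_le y1 with hl | hl
    · rw [if_pos (by omega), h.left y hl.ge]; omega
    rcases lt_or_ge t (2 * (m + y)) with hq | hq
    · have := h.le_left hm ht hg hv y1 hy0 (by omega) hq
      split_ifs <;> omega
    -- Here the bound on `G y` is 0, so no large chip is left of y and the odometer alone gives `n
    -- y`.
    · rw [if_pos (by omega)]
      obtain ⟨G, h1, h2, h3⟩ := h.large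
      have hG : ∀ k : ℕ, 0 ≤ G (-m + k) := by
        intro k
        induction k with
        | zero => simp [h2]
        | succ k ih =>
          have := hv.large_nonneg hm hg h (-m + k + 1)
          have := h1 (-m + k)
          push_cast; rw [← add_assoc]; omega
      have k1 := hG (y - 1 + m).toNat
      rw [show -m + ((y - 1 + m).toNat : ℤ) = y - 1 by omega] at k1
      have k2 := h1 (y - 1)
      rw [sub_add_cancel] at k2
      have k3 := h3 y
      rw [reachBound_eq_zero (by omega)] at k3
      have k4 := hg.le_todo_outer hy0 (by omega)
      unfold tail at k2
      unfold todo at k4 ha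
      rw [finalOdo_left (by omega) (by omega)] at k4 ha
      rw [finalOdo_left (by omega) (by omega)] at k4
      rw [if_pos hy0] at k2
      unfold todo
      rw [finalOdo_left (by omega) (by omega), ha]
      nlinarith
  · rw [abs_of_pos hy0] at ha
    have := h.le_right hm htm hg hv y2 hy0 ha
    rw [if_neg (by omega)]
    omega

lemma endBounded_zero (hm : 1 ≤ m) (ht : 1 ≤ t) (htm : t ≤ m)
    (hv : Valid m (fun _ => 0) n) (h : Spread m t (fun _ => 0) n) :
    EndBounded m t (fun _ => 0) n := by
  intro y hy ha
  have := le_finalOdo m y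
  exact h.endBound_of_eq hm ht htm good_zero hv hy
    (le_antisymm ha (by unfold todo; simpa using this))

/-- Since the firing site holds exactly three chips, either a small chip goes left and the bound at
z may drop by one, or all three are large and `n z = n (z + 1)` inherits the stricter bound at z+1.
The count at z+1 grows only if all three are small, and then it becomes `n z - 2`. -/
lemma EndBounded.step (hm : 1 ≤ m) (ht : 1 ≤ t) (htm : t ≤ m) (hg : Good m f)
    (hv : Valid m f n) (h : Spread m t f n) (hv' : Valid m f' n') (he : EndBounded m t f n)
    (hs : UnitStep m f n f' n') : EndBounded m t f' n' := by
  have h' := h.step hm hg hs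
  obtain ⟨z, L, R, hz, rfl, hn, hLR⟩ := hs
  have hzm := hg.abs_lt_of_load hm (by omega : 2 ≤ load m f z)
  have hzm' := abs_lt.mp hzm
  intro y hy ha
  have hg' := hg.step hm hz
  rcases eq_or_lt_of_le ha with ha | ha
  · exact h'.endBound_of_eq hm ht htm hg' hv' hy ha
  obtain ⟨y1, y2⟩ := abs_le.mp hy
  by_cases hyz : y = z
  · subst hyz
    rw [todo_update_self] at ha ⊢
    have i1 := he y hy (by omega)
    have i2 := hn y
    rw [if_pos rfl, if_neg (by omega)] at i2
    have i3 := hv.anti y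
    have i4 := hg.load_at_step hm hz (by omega)
    have i5 : todo m f (y + 1) ≤ m - |y + 1| ∧ (y < 0 → todo m f (y + 1) = todo m f y) ∧
        (0 ≤ y → todo m f (y + 1) = todo m f y - 1) := by
      rcases lt_or_ge y 0 with hy0 | hy0
      · rw [abs_of_neg hy0] at ha
        have := (hg.todo_at_step hm hz hy0.le (by omega)).2 hy0
        rw [abs_of_nonpos (by omega)]
        omega
      · rw [abs_of_nonneg hy0] at ha
        have := (hg.todo_at_step' hm hz hy0 (by omega)).1
        rw [abs_of_nonneg (by omega)]
        omega
    have i6 := he (y + 1) (abs_le.mpr (by omega)) i5.1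
    have i7 := hg'.todo_nonneg y
    rw [todo_update_self] at i7
    unfold endBound at *
    split_ifs at * <;> omega
  · rw [todo_update_of_ne hyz] at ha ⊢
    have i1 := he y hy ha.le
    have i2 := hn y
    rw [if_neg hyz] at i2
    by_cases hyz' : y = z + 1
    · rw [if_pos hyz'] at i2
      subst hyz'
      have i5 : todo m f z ≤ m - |z| ∧ (z < 0 → todo m f (z + 1) = todo m f z) ∧
        (0 ≤ z → todo m f (z + 1) = todo m f z - 1) := by
        rcases lt_or_ge z 0 with hz0 | hz0
        · rw [abs_of_nonpos (by omega)] at ha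
          rw [abs_of_neg hz0]
          have j1 := hg.todo_outer_le (x := z + 1) (by omega) (by omega)
          rw [add_sub_cancel_right] at j1
          have := (hg.todo_at_step hm hz hz0.le (by omega)).2 hz0
          omega
        · rw [abs_of_nonneg (by omega)] at ha
          rw [abs_of_nonneg hz0]
          have j1 := hg.todo_inner_le' (i := z + 1) (by omega) (by omega)
          rw [add_sub_cancel_right] at j1
          have := (hg.todo_at_step' hm hz hz0 (by omega)).1
          omega
      have i4 := hg.load_at_step hm hz i5.1
      have i6 := he z hzm.le i5.1
      have i7 := hv.le z
      unfold endBound at *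
      split_ifs at * <;> omega
    · rw [if_neg hyz'] at i2
      omega

/-- The invariants of the unit process. -/
structure Inv (m t : ℤ) (f n : ℤ → ℤ) : Prop where
  good : Good m f
  valid : Valid m f n
  spread : Spread m t f n
  endBounded : EndBounded m t f n

lemma inv_zero (hm : 1 ≤ m) (ht : 1 ≤ t) (htm : t ≤ m) :
    Inv m t (fun _ => 0) (fun y => if y ≤ 0 then 2 * t - 1 else 0) := by
  have hv : Valid m (fun _ => 0) (fun y => if y ≤ 0 then 2 * t - 1 else 0) := by
    constructor
    · intro y; split_ifs <;> omega
    · intro y; rw [load_eq]; split_ifs <;> omega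
  exact ⟨good_zero, hv, spread_zero hm, endBounded_zero hm ht htm hv (spread_zero hm)⟩

lemma Inv.step (hm : 1 ≤ m) (ht : 1 ≤ t) (htm : t ≤ m) (h : Inv m t f n)
    (hs : UnitStep m f n f' n') (hv' : Valid m f' n') : Inv m t f' n' where
  good := by obtain ⟨z, L, R, hz, rfl, -⟩ := hs; exact h.good.step hm hz
  valid := hv'
  spread := h.spread.step hm h.good hs
  endBounded := h.endBounded.step hm ht htm h.good h.valid h.spread hv' hs

/-- In a stable state, the small chips are left of `t - m`. -/
lemma Inv.eq_zero (hm : 1 ≤ m) (ht : 1 ≤ t) (htm : t ≤ m) (h : Inv m t f n)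
    (hs : ∀ i, load m f i ≤ 2) : n (t - m) = 0 := by
  have h1 := h.endBounded (t - m) (abs_le.mpr (by omega))
  rw [h.good.todo_eq_zero hm hs, endBound, if_pos le_rfl] at h1
  have := h1 (by rw [abs_of_nonpos (by omega)]; omega)
  have := h.valid.small_nonneg h.spread (t - m)
  omega

end LabeledChipFiring

/-! ### From labeled moves to bundles of r chips -/

namespace LabeledChipFiring

open Finset

section rank

variable {α : Type*} {lt : α → α → Prop} [DecidableRel lt]

lemma card_filter_rank_lt [DecidableEq α] (htrans : ∀ a b c, lt a b → lt b c → lt a c)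
    (hirr : ∀ a, ¬ lt a a) (htri : ∀ a b, a ≠ b → lt a b ∨ lt b a) (S : Finset α) {r : ℕ}
    (hr : r ≤ S.card) :
    (S.filter fun a => (S.filter fun b => lt b a).card < r).card = r := by
  set rank : α → ℕ := fun a => (S.filter fun b => lt b a).card with hrank
  have mono : ∀ a ∈ S, ∀ b ∈ S, lt a b → rank a < rank b := by
    intro a ha b hb hab
    refine card_lt_card ⟨fun c hc => ?_, fun hsub => ?_⟩
    · rw [mem_filter] at hc ⊢
      exact ⟨hc.1, htrans _ _ _ hc.2 hab⟩
    · exact hirr a (mem_filter.mp (hsub (mem_filter.mpr ⟨ha, hab⟩))).2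
  have inj : Set.InjOn rank S := by
    intro a ha b hb hab
    by_contra hne
    rcases htri a b hne with h | h
    · exact absurd hab (mono a ha b hb h).ne
    · exact absurd hab (mono b hb a ha h).ne'
  have img : S.image rank = range S.card := by
    refine eq_of_subset_of_card_le (fun k hk => ?_) ?_
    · obtain ⟨a, ha, rfl⟩ := mem_image.mp hk
      rw [mem_range]
      refine card_lt_card ⟨filter_subset _ _, fun hsub => ?_⟩
      exact hirr a (mem_filter.mp (hsub ha)).2
    · rw [card_range, card_image_of_injOn inj]
  have : (S.filter fun a => rank a < r).image rank = range r := by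
    ext k
    simp only [mem_image, mem_filter, mem_range]
    constructor
    · rintro ⟨a, ⟨-, h⟩, rfl⟩; exact h
    · intro hk
      have : k ∈ S.image rank := by rw [img, mem_range]; omega
      obtain ⟨a, ha, rfl⟩ := mem_image.mp this
      exact ⟨a, ⟨ha, hk⟩, rfl⟩
  rw [← card_image_of_injOn (inj.mono fun _ h => (mem_filter.mp h).1), this, card_range]

end rank

variable {n r : ℕ} {S : Finset (Fin n)}

lemma card_smallest (hr : r ≤ S.card) : (smallest r S).card = r :=
  card_filter_rank_lt (lt := fun a b : Fin n => a < b) (fun _ _ _ => lt_trans) lt_irrefl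
    (fun _ _ => lt_or_gt_of_ne) S hr

lemma card_largest (hr : r ≤ S.card) : (largest r S).card = r :=
  card_filter_rank_lt (lt := fun a b : Fin n => b < a) (fun _ _ _ h1 h2 => lt_trans h2 h1)
    lt_irrefl (fun _ _ h => (lt_or_gt_of_ne h).symm) S hr

lemma lt_of_mem_smallest {a b : Fin n} (ha : a ∈ smallest r S) (hb : b ∈ S)
    (hb' : b ∉ smallest r S) : a < b := by
  by_contra hc
  refine hb' (mem_filter.mpr ⟨hb, lt_of_le_of_lt (card_le_card fun c hc' => ?_)
    (mem_filter.mp ha).2⟩)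
  rw [mem_filter] at hc' ⊢
  exact ⟨hc'.1, lt_of_lt_of_le hc'.2 (not_lt.mp hc)⟩

lemma lt_of_mem_largest {a b : Fin n} (ha : a ∈ largest r S) (hb : b ∈ S)
    (hb' : b ∉ largest r S) : b < a := by
  by_contra hc
  refine hb' (mem_filter.mpr ⟨hb, lt_of_le_of_lt (card_le_card fun c hc' => ?_)
    (mem_filter.mp ha).2⟩)
  rw [mem_filter] at hc' ⊢
  exact ⟨hc'.1, lt_of_le_of_lt (not_lt.mp hc) hc'.2⟩

lemma disjoint_smallest_largest (hS : 2 * r ≤ S.card) :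
    Disjoint (smallest r S) (largest r S) := by
  rw [disjoint_left]
  intro a h1 h2
  obtain ⟨ha, h1⟩ := mem_filter.mp h1
  have h2 := (mem_filter.mp h2).2
  have : S ⊆ insert a ((S.filter fun b => b < a) ∪ S.filter fun b => a < b) := by
    intro b hb
    rcases lt_trichotomy b a with h | h | h <;> simp [h, hb]
  have h3 := card_le_card this
  have h4 := card_insert_le a ((S.filter fun b => b < a) ∪ S.filter fun b => a < b)
  have h5 := card_union_le (S.filter fun b => b < a) (S.filter fun b => a < b)
  omega

/-- The chips of `S` that stay in place when `S` fires. -/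
def middle (r : ℕ) (S : Finset (Fin n)) : Finset (Fin n) := (S \ smallest r S) \ largest r S

lemma card_middle (hS : S.card = 3 * r) : (middle r S).card = r := by
  have h1 : smallest r S ⊆ S := filter_subset _ _
  have h2 : largest r S ⊆ S \ smallest r S := fun a ha => mem_sdiff.mpr
    ⟨filter_subset _ _ ha, disjoint_right.mp (disjoint_smallest_largest (by omega)) ha⟩
  rw [middle, card_sdiff_of_subset h2, card_sdiff_of_subset h1, card_smallest (by omega),
    card_largest (by omega)]
  omega

/-- The number of chips in `U` at or to the right of `y`. -/
def count (U : Finset (Fin n)) (p : Config n) (y : ℤ) : ℤ := (U.filter fun a => y ≤ p a).card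

variable {U : Finset (Fin n)} {p q : Config n}

lemma count_sub (y : ℤ) :
    count U p y - count U p (y + 1) = (U.filter fun a => p a = y).card := by
  have : (U.filter fun a => y ≤ p a) =
      (U.filter fun a => y + 1 ≤ p a) ∪ U.filter fun a => p a = y := by
    rw [← filter_or]
    exact filter_congr fun a _ => by omega
  unfold count
  rw [this, card_union_of_disjoint]
  · push_cast; ring
  · rw [disjoint_filter]; intro a _ h; omega

lemma count_anti (y : ℤ) : count U p (y + 1) ≤ count U p y := by
  have := count_sub (U := U) (p := p) y
  omega

lemma count_sub_le (y : ℤ) :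
    count U p y - count U p (y + 1) ≤ count univ p y - count univ p (y + 1) := by
  rw [count_sub, count_sub]
  exact_mod_cast card_le_card (filter_subset_filter _ (subset_univ U))

lemma count_fire {i : ℤ} (hS : S.card = 3 * r) (hSi : ∀ a ∈ S, p a = i)
    (h1 : ∀ a ∈ smallest r S, q a = i - 1) (h2 : ∀ a ∈ largest r S, q a = i + 1)
    (h3 : ∀ a, a ∉ smallest r S → a ∉ largest r S → q a = p a) (y : ℤ) :
    count U q y = count U p y - (if y = i then ((U.filter (· ∈ smallest r S)).card : ℤ) else 0)
      + (if y = i + 1 then ((U.filter (· ∈ largest r S)).card : ℤ) else 0) := by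
  have hd := disjoint_smallest_largest (r := r) (S := S) (by omega)
  have e : ∀ a, ((if y ≤ q a then 1 else 0) : ℤ) = (if y ≤ p a then 1 else 0)
      - (if y = i then (if a ∈ smallest r S then 1 else 0) else 0)
      + (if y = i + 1 then (if a ∈ largest r S then 1 else 0) else 0) := by
    intro a
    by_cases ha : a ∈ smallest r S
    · have := disjoint_left.mp hd ha
      rw [h1 a ha, hSi a (filter_subset _ _ ha), if_pos ha, if_neg this]
      split_ifs <;> omega
    · by_cases hb : a ∈ largest r S
      · rw [h2 a hb, hSi a (filter_subset _ _ hb), if_pos hb, if_neg ha]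
        split_ifs <;> omega
      · rw [h3 a ha hb, if_neg ha, if_neg hb]
        simp
  unfold count
  simp only [card_filter]
  push_cast
  rw [sum_congr rfl fun a _ => e a, sum_add_distrib, sum_sub_distrib]
  split_ifs <;> simp

/-- The quotient of `x` by `r`, rounded up. -/
def ceilDiv (r : ℕ) (x : ℤ) : ℤ := -(-x / r)

lemma ceilDiv_le (hr : 1 ≤ r) {x y c : ℤ} (h : x ≤ y + r * c) :
    ceilDiv r x ≤ ceilDiv r y + c := by
  have hr' : (0 : ℤ) < r := by exact_mod_cast hr
  have : (-y + (-c) * r) / r ≤ -x / r := Int.ediv_le_ediv hr' (by linarith)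
  rw [Int.add_mul_ediv_right _ _ hr'.ne'] at this
  unfold ceilDiv
  omega

lemma ceilDiv_mul (hr : 1 ≤ r) (c : ℤ) : ceilDiv r (r * c) = c := by
  have hr' : (r : ℤ) ≠ 0 := by positivity
  rw [ceilDiv, ← mul_neg, Int.mul_ediv_cancel_left _ hr', neg_neg]

/-- The state of the unit process that is obtained by rounding up the numbers of the chips in `U`,
measured in bundles of `r`. -/
def bundled (r : ℕ) (U : Finset (Fin n)) (p : Config n) (y : ℤ) : ℤ := ceilDiv r (count U p y)

lemma valid_bundled (hr : 1 ≤ r) {m : ℤ} {f : ℤ → ℤ} (hT : ∀ y, count univ p y = r * tail m f y) :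
    Valid m f (bundled r U p) where
  anti y := by
    have := ceilDiv_le hr (c := 0) (by simpa using count_anti (U := U) (p := p) y)
    simpa [bundled] using this
  le y := by
    have h := count_sub_le (U := U) (p := p) y
    rw [hT, hT, ← mul_sub] at h
    have := ceilDiv_le hr (x := count U p y) (y := count U p (y + 1)) (c := load m f y)
      (by unfold load; linarith)
    unfold bundled; omega

/-- The r chips of S that stay decide the case: as `U` is closed downward, they all lie in `U` if
some chip sent right does, and all outside `U` if some chip sent left is outside. -/
lemma unitStep_bundled (hr : 1 ≤ r) {m : ℤ} {f : ℤ → ℤ} {i : ℤ}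
    (hT' : ∀ y, count univ q y = r * tail m (Function.update f i (f i + 1)) y)
    (hl : 3 ≤ load m f i)
    (hU : ∀ a b : Fin n, a < b → b ∈ U → a ∈ U)
    (hS : S.card = 3 * r) (hSi : ∀ a ∈ S, p a = i)
    (h1 : ∀ a ∈ smallest r S, q a = i - 1) (h2 : ∀ a ∈ largest r S, q a = i + 1)
    (h3 : ∀ a, a ∉ smallest r S → a ∉ largest r S → q a = p a) :
    UnitStep m f (bundled r U p) (Function.update f i (f i + 1)) (bundled r U q) := by
  have hq := count_fire (U := U) hS hSi h1 h2 h3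
  have hqm : ∀ a ∈ middle r S, a ∈ S ∧ a ∉ smallest r S ∧ a ∉ largest r S ∧ q a = i := by
    intro a ha
    simp only [middle, mem_sdiff] at ha
    exact ⟨ha.1.1, ha.1.2, ha.2, (h3 a ha.1.2 ha.2).trans (hSi a ha.1.1)⟩
  set s := (U.filter (· ∈ smallest r S)).card with hs
  set l := (U.filter (· ∈ largest r S)).card with hlr
  have hsr : s ≤ r := by
    rw [← card_smallest (r := r) (S := S) (by omega)]
    exact card_le_card fun a ha => (mem_filter.mp ha).2
  have hlr' : l ≤ r := by
    rw [← card_largest (r := r) (S := S) (by omega)]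
    exact card_le_card fun a ha => (mem_filter.mp ha).2
  have hqi := hq i
  rw [if_pos rfl, if_neg (by omega), add_zero] at hqi
  have hqi1 := hq (i + 1)
  rw [if_neg (by omega), if_pos rfl, sub_zero] at hqi1
  have a1 := ceilDiv_le hr (x := count U q i) (y := count U p i) (c := 0) (by rw [hqi]; simp)
  have a2 := ceilDiv_le hr (x := count U p i) (y := count U q i) (c := 1) (by rw [hqi]; simp; omega)
  have a3 := ceilDiv_le hr (x := count U p (i + 1)) (y := count U q (i + 1)) (c := 0)
    (by rw [hqi1]; simp)
  have a4 := ceilDiv_le hr (x := count U q (i + 1)) (y := count U p (i + 1)) (c := 1)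
    (by rw [hqi1]; simp; omega)
  refine ⟨i, bundled r U p i - bundled r U q i, bundled r U q (i + 1) - bundled r U p (i + 1),
    hl, rfl, fun y => ?_, ?_⟩
  · by_cases hy : y = i
    · subst hy; rw [if_pos rfl, if_neg (by omega)]; ring
    · by_cases hy' : y = i + 1
      · subst hy'; rw [if_neg hy, if_pos rfl]; ring
      · rw [if_neg hy, if_neg hy', bundled, hq y, if_neg hy, if_neg hy', bundled]; ring_nf
  unfold bundled
  rcases eq_or_lt_of_le hsr with hsr | hsr
  · have a5 := ceilDiv_le hr (x := count U q i) (y := count U p i) (c := -1)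
      (by rw [hqi, hsr]; linarith)
    rcases Nat.eq_zero_or_pos l with hl0 | hl0
    · rw [hl0] at hqi1
      rw [hqi1]; simp only [Nat.cast_zero, add_zero]; omega
    · obtain ⟨b, hb⟩ := card_pos.mp hl0
      obtain ⟨hbU, hb⟩ := mem_filter.mp hb
      -- The staying chips of S give one full unit at i after the move. If L = R = 1, there were
      -- thus three before it.
      have a6 : (r : ℤ) ≤ count U q i - count U q (i + 1) := by
        rw [count_sub, ← card_middle hS]
        refine Int.ofNat_le.mpr (card_le_card fun a ha => ?_)
        obtain ⟨b1, b2, b3, b4⟩ := hqm a ha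
        exact mem_filter.mpr ⟨hU a b (lt_of_mem_largest hb b1 b3) hbU, b4⟩
      have a7 := ceilDiv_le hr (x := count U q (i + 1)) (y := count U q i) (c := -1)
        (by linarith)
      omega
  · obtain ⟨b, hb, hbU⟩ : ∃ b ∈ smallest r S, b ∉ U := by
      by_contra hc
      push Not at hc
      refine hsr.not_ge ?_
      rw [← card_smallest (r := r) (S := S) (by omega)]
      exact card_le_card fun a ha => mem_filter.mpr ⟨hc a ha, ha⟩
    have large : ∀ a ∈ S, a ∉ smallest r S → a ∉ U := fun a ha ha' haU =>
      hbU (hU b a (lt_of_mem_smallest hb ha ha') haU)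
    have hl0 : l = 0 := by
      rw [hlr, card_eq_zero, filter_eq_empty_iff]
      intro a haU ha
      exact large a (filter_subset _ _ ha)
        (disjoint_right.mp (disjoint_smallest_largest (by omega)) ha) haU
    rw [hl0] at hqi1
    -- The staying chips of S are large, which leaves room for at most `load - 3` units of `U` at i.
    -- This is the required inequality if L = 0.
    have a6 : count U q i - count U q (i + 1) + r ≤
        count univ q i - count univ q (i + 1) := by
      rw [count_sub, count_sub, ← card_middle hS]
      rw [← Nat.cast_add, ← card_union_of_disjoint]
      · refine Int.ofNat_le.mpr (card_le_card fun a ha => ?_)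
        rw [mem_filter]
        refine ⟨mem_univ _, ?_⟩
        rcases mem_union.mp ha with ha | ha
        · exact (mem_filter.mp ha).2
        · exact (hqm a ha).2.2.2
      · rw [disjoint_right]
        intro a ha ha'
        obtain ⟨b1, b2, -⟩ := hqm a ha
        exact large a b1 b2 (mem_filter.mp ha').1
    rw [hT', hT', tail_update, tail_update, if_pos rfl, if_neg (by omega), if_neg (by omega),
      if_pos rfl] at a6
    have a7 := ceilDiv_le hr (x := count U q i) (y := count U q (i + 1)) (c := load m f i - 3)
      (by unfold load; linarith)
    rw [hqi1] at a7 ⊢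
    simp only [Nat.cast_zero, add_zero] at a7 ⊢
    omega

end LabeledChipFiring

/-! ### Termination and final positions of labeled chips -/

namespace LabeledChipFiring

open Finset

variable {n r m : ℕ} {p q : Config n} {f : ℤ → ℤ}

/-- The chips with the `k` smallest labels. -/
def lowest (n k : ℕ) : Finset (Fin n) := univ.filter fun a => a.val < k

lemma card_lowest {k : ℕ} (hk : k ≤ n) : (lowest n k).card = k := by
  rw [lowest, Fin.card_filter_val_lt, min_eq_right hk]

/-- The configuration `p` satisfies the invariants, with odometer `f`. -/
structure Tracks (r m : ℕ) (p : Config n) (f : ℤ → ℤ) : Prop where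
  count_univ : ∀ y, count univ p y = r * tail m f y
  inv : ∀ t : ℕ, 1 ≤ t → t ≤ m → Inv m t f (bundled r (lowest n (r * (2 * t - 1))) p)

lemma count_atOrigin (U : Finset (Fin n)) (y : ℤ) :
    count U (atOrigin n) y = if y ≤ 0 then (U.card : ℤ) else 0 := by
  unfold count atOrigin
  split_ifs with h <;> simp [h]

lemma tracks_atOrigin (hr : 1 ≤ r) (hm : 1 ≤ m) (hn : n = r * (4 * m - 1)) :
    Tracks r m (atOrigin n) (fun _ => 0) where
  count_univ y := by
    rw [count_atOrigin, card_univ, Fintype.card_fin, hn, tail]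
    push_cast [Nat.cast_sub (show 1 ≤ 4 * m by omega)]
    split_ifs <;> simp
  inv t ht htm := by
    have hk : r * (2 * t - 1) ≤ n := by rw [hn]; exact Nat.mul_le_mul_left _ (by omega)
    have : bundled r (lowest n (r * (2 * t - 1))) (atOrigin n) =
        fun y : ℤ => if y ≤ 0 then 2 * (t : ℤ) - 1 else 0 := by
      funext y
      rw [bundled, count_atOrigin, card_lowest hk]
      split_ifs
      · push_cast [Nat.cast_sub (show 1 ≤ 2 * t by omega)]
        rw [ceilDiv_mul hr]
      · simp [ceilDiv]
    rw [this]
    exact inv_zero (by omega) (by omega) (by omega)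

lemma Tracks.good (hm : 1 ≤ m) (h : Tracks r m p f) : Good m f := (h.inv 1 le_rfl hm).good

lemma Tracks.step (hr : 1 ≤ r) (hm : 1 ≤ m) (h : Tracks r m p f) (hpq : Fires r p q) :
    ∃ z : ℤ, |z| < m ∧ Tracks r m q (Function.update f z (f z + 1)) := by
  obtain ⟨i, S, hS, hSi, h1, h2, h3⟩ := hpq
  have hl : 3 ≤ load m f i := by
    have : (3 * r : ℤ) ≤ r * load m f i := by
      rw [load, mul_sub, ← h.count_univ, ← h.count_univ, count_sub]
      have := card_le_card (fun a ha => mem_filter.mpr ⟨mem_univ a, hSi a ha⟩ :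
        S ⊆ univ.filter fun a => p a = i)
      rw [hS] at this
      exact_mod_cast this
    have hr' : (0 : ℤ) < r := by exact_mod_cast hr
    nlinarith
  refine ⟨i, (h.good hm).abs_lt_of_load (by omega) (by omega : 2 ≤ load m f i), ?_⟩
  have hT' : ∀ y, count univ q y = r * tail m (Function.update f i (f i + 1)) y := by
    intro y
    rw [count_fire hS hSi h1 h2 h3, h.count_univ, tail_update, filter_mem_eq_inter,
      filter_mem_eq_inter, univ_inter, univ_inter, card_smallest (by omega),
      card_largest (by omega)]
    split_ifs <;> ring
  refine ⟨hT', fun t ht htm => ?_⟩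
  refine (h.inv t ht htm).step (by omega) (by omega) (by omega)
    (unitStep_bundled hr hT' hl ?_ hS hSi h1 h2 h3) (valid_bundled hr hT')
  intro a b hab hb
  simp only [lowest, mem_filter, mem_univ, true_and] at hb ⊢
  exact lt_trans hab hb

lemma Tracks.of_reachable (hr : 1 ≤ r) (hm : 1 ≤ m) (hn : n = r * (4 * m - 1))
    (h : Reachable r p) : ∃ f, Tracks r m p f := by
  unfold Reachable at h
  induction h with
  | refl => exact ⟨_, tracks_atOrigin hr hm hn⟩
  | tail _ hpq ih =>
    obtain ⟨f, hf⟩ := ih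
    obtain ⟨z, -, hz⟩ := hf.step hr hm hpq
    exact ⟨_, hz⟩

/-- Each move raises the total odometer on [-m, m] by one, and `finalOdo` bounds it. -/
theorem not_exists_infinite (hr : 1 ≤ r) (hm : 1 ≤ m) (hn : n = r * (4 * m - 1)) :
    ¬ ∃ c : ℕ → Config n, c 0 = atOrigin n ∧ ∀ t : ℕ, Fires r (c t) (c (t + 1)) := by
  rintro ⟨c, h0, hc⟩
  have key : ∀ k : ℕ, ∃ f, Tracks r m (c k) f ∧ ∑ i ∈ Icc (-(m : ℤ)) m, f i = k := by
    intro k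
    induction k with
    | zero => exact ⟨_, h0 ▸ tracks_atOrigin hr hm hn, by simp⟩
    | succ k ih =>
      obtain ⟨f, hf, hk⟩ := ih
      obtain ⟨z, hz, hz'⟩ := hf.step hr hm (hc k)
      refine ⟨_, hz', ?_⟩
      have hz := abs_lt.mp hz
      have hmem : z ∈ Icc (-(m : ℤ)) m := by rw [mem_Icc]; omega
      have h1 := sum_update_of_mem hmem f (f z + 1)
      have h2 := sum_update_of_mem hmem f (f z)
      rw [Function.update_eq_self] at h2
      push_cast
      linarith
  obtain ⟨f, hf, hk⟩ := key ((∑ i ∈ Icc (-(m : ℤ)) m, finalOdo m i).toNat + 1)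
  have : ∑ i ∈ Icc (-(m : ℤ)) m, f i ≤ ∑ i ∈ Icc (-(m : ℤ)) m, finalOdo m i :=
    sum_le_sum fun i _ => (hf.good hm).le i
  omega

lemma exists_fires {i : ℤ} (h : 3 * r ≤ (univ.filter fun a => p a = i).card) :
    ∃ q, Fires r p q := by
  obtain ⟨S, hS, hcard⟩ := exists_subset_card_eq h
  have hSi : ∀ a ∈ S, p a = i := fun a ha => (mem_filter.mp (hS ha)).2
  refine ⟨fun a => if a ∈ smallest r S then i - 1 else if a ∈ largest r S then i + 1 else p a,
    i, S, hcard, hSi, fun a ha => if_pos ha, fun a ha => ?_, fun a ha hb => ?_⟩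
  · dsimp only
    rw [if_neg (disjoint_right.mp (disjoint_smallest_largest (by omega)) ha), if_pos ha]
  · dsimp only
    rw [if_neg ha, if_neg hb]

lemma card_filter_lt (y : ℤ) : ((univ.filter fun a => p a < y).card : ℤ) = n - count univ p y := by
  have := card_filter_add_card_filter_not (s := (univ : Finset (Fin n))) (fun a => p a < y)
  rw [card_univ, Fintype.card_fin] at this
  simp only [not_lt] at this
  unfold count
  omega

/-- The positions of the chips with small labels in a final configuration. -/
lemma lt_iff_of_isFinal (hr : 1 ≤ r) (hn : n = r * (4 * m - 1)) (h : Reachable r p)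
    (hp : IsFinal r p) {t : ℕ} (ht : 1 ≤ t) (htm : t ≤ m) (a : Fin n) :
    p a < t - m ↔ a.val < r * (2 * t - 1) := by
  have hm : 1 ≤ m := by omega
  obtain ⟨f, hf⟩ := Tracks.of_reachable hr hm hn h
  have hs : ∀ i, load m f i ≤ 2 := by
    intro i
    by_contra hc
    have : (3 * r : ℤ) ≤ r * load m f i := by nlinarith [show 3 ≤ load m f i by omega]
    rw [load, mul_sub, ← hf.count_univ, ← hf.count_univ, count_sub] at this
    obtain ⟨q, hq⟩ := exists_fires (r := r) (p := p) (i := i) (by exact_mod_cast this)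
    exact hp q hq
  have hz := (hf.inv t ht htm).eq_zero (by omega) (by omega) (by omega) hs
  have h0 : count (lowest n (r * (2 * t - 1))) p (t - m) = 0 := by
    have hr' : (0 : ℤ) < r := by exact_mod_cast hr
    have h1 : 0 ≤ count (lowest n (r * (2 * t - 1))) p (t - m) := Int.natCast_nonneg _
    by_contra hc
    have := ceilDiv_le hr (x := r * 1) (y := count (lowest n (r * (2 * t - 1))) p (t - m) + (r - 1))
      (c := 0) (by omega)
    unfold bundled ceilDiv at hz
    have h2 : -count (lowest n (r * (2 * t - 1))) p (t - m) / (r : ℤ) < 0 :=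
      Int.ediv_neg_of_neg_of_pos (by omega) hr'
    omega
  have hsub : lowest n (r * (2 * t - 1)) ⊆ univ.filter fun a => p a < t - m := by
    intro a ha
    rw [count, Nat.cast_eq_zero, card_eq_zero, filter_eq_empty_iff] at h0
    exact mem_filter.mpr ⟨mem_univ _, not_le.mp (h0 ha)⟩
  -- The final odometer is t² at t-m and (t-1)² at t-m-1, and the difference is 2t-1.
  have hcard : (univ.filter fun a => p a < t - m).card = r * (2 * t - 1) := by
    have h1 := card_filter_lt (p := p) (t - m)
    have e1 := (hf.good hm).todo_eq_zero (by omega) hs (t - m)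
    have e2 := (hf.good hm).todo_eq_zero (by omega) hs (t - m - 1)
    unfold todo at e1 e2
    rw [finalOdo_left (by omega) (by omega)] at e1 e2
    rw [hf.count_univ, tail, if_pos (by omega), ← sub_eq_zero.mp e1, ← sub_eq_zero.mp e2] at h1
    have h2 : (n : ℤ) = r * (4 * m - 1) := by
      rw [hn]; push_cast [Nat.cast_sub (show 1 ≤ 4 * m by omega)]; ring
    have h3 : ((r * (2 * t - 1) : ℕ) : ℤ) = r * (2 * t - 1) := by
      push_cast [Nat.cast_sub (show 1 ≤ 2 * t by omega)]; ring
    apply Nat.cast_injective (R := ℤ)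
    rw [h1, h3, h2]; ring
  have heq := eq_of_subset_of_card_le hsub (by
    rw [hcard, card_lowest (by rw [hn]; exact Nat.mul_le_mul_left _ (by omega))])
  have := congrArg (a ∈ ·) heq
  simpa [lowest] using this.symm

lemma neg_le_of_reachable (hr : 1 ≤ r) (hm : 1 ≤ m) (hn : n = r * (4 * m - 1))
    (h : Reachable r p) (a : Fin n) : -(m : ℤ) ≤ p a := by
  obtain ⟨f, hf⟩ := Tracks.of_reachable hr hm hn h
  have h1 := card_filter_lt (p := p) (-(m : ℤ))
  have z : ∀ j : ℤ, (m : ℤ) ≤ |j| → f j = 0 := fun j hj => by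
    have := (hf.good hm).le j
    have := (hf.good hm).nonneg j
    have := finalOdo_of_le hj
    omega
  rw [hf.count_univ, tail, if_pos (by omega), z _ (le_trans (by omega) (neg_le_abs _)),
    z _ (le_trans (by omega) (neg_le_abs _))] at h1
  have hn' : (n : ℤ) = r * (4 * m - 1) := by
    rw [hn]; push_cast [Nat.cast_sub (show 1 ≤ 4 * m by omega)]; ring
  have h2 : (univ.filter fun a => p a < -(m : ℤ)).card = 0 := by
    zify; rw [h1, hn']; ring
  rw [card_eq_zero, filter_eq_empty_iff] at h2
  exact not_lt.mp (h2 (mem_univ a))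

/-! ### Reflection and sorting -/

/-- The mirror image of a configuration. -/
def mirror (p : Config n) : Config n := fun a => -p (Fin.rev a)

lemma mirror_mirror (p : Config n) : mirror (mirror p) = p := by
  funext a; simp [mirror]

lemma mem_smallest_image_rev {S : Finset (Fin n)} {a : Fin n} :
    a ∈ smallest r (S.image Fin.rev) ↔ Fin.rev a ∈ largest r S := by
  have : ((S.image Fin.rev).filter fun b => b < a) =
      (S.filter fun b => Fin.rev a < b).image Fin.rev := by
    ext b
    simp only [mem_filter, mem_image]
    constructor
    · rintro ⟨⟨c, hc, rfl⟩, h⟩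
      exact ⟨c, ⟨hc, Fin.rev_lt_iff.mp h⟩, rfl⟩
    · rintro ⟨c, ⟨hc, h⟩, rfl⟩
      exact ⟨⟨c, hc, rfl⟩, Fin.rev_lt_iff.mpr h⟩
  rw [smallest, largest, mem_filter, mem_filter, this, card_image_of_injective _ Fin.rev_injective]
  refine and_congr ?_ Iff.rfl
  simp only [mem_image]
  constructor
  · rintro ⟨c, hc, rfl⟩; rwa [Fin.rev_rev]
  · intro h; exact ⟨_, h, Fin.rev_rev a⟩

lemma mem_largest_image_rev {S : Finset (Fin n)} {a : Fin n} :
    a ∈ largest r (S.image Fin.rev) ↔ Fin.rev a ∈ smallest r S := by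
  have h : (S.image Fin.rev).image Fin.rev = S := by
    rw [image_image]; simp [Function.comp_def]
  rw [← Fin.rev_rev a, ← mem_smallest_image_rev, h, Fin.rev_rev]

lemma Fires.mirror (h : Fires r p q) : Fires r (mirror p) (mirror q) := by
  obtain ⟨i, S, hS, hSi, h1, h2, h3⟩ := h
  refine ⟨-i, S.image Fin.rev, ?_, fun a ha => ?_, fun a ha => ?_, fun a ha => ?_,
    fun a ha hb => ?_⟩
  · rw [card_image_of_injective _ Fin.rev_injective, hS]
  · obtain ⟨b, hb, rfl⟩ := mem_image.mp ha
    rw [LabeledChipFiring.mirror, Fin.rev_rev, hSi b hb]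
  · rw [LabeledChipFiring.mirror, h2 _ (mem_smallest_image_rev.mp ha)]; ring
  · rw [LabeledChipFiring.mirror, h1 _ (mem_largest_image_rev.mp ha)]; ring
  · rw [LabeledChipFiring.mirror, LabeledChipFiring.mirror,
      h3 _ (fun h => hb (mem_largest_image_rev.mpr h))
        (fun h => ha (mem_smallest_image_rev.mpr h))]

lemma Reachable.mirror (h : Reachable r p) : Reachable r (mirror p) := by
  unfold Reachable at h
  induction h with
  | refl =>
    have : LabeledChipFiring.mirror (atOrigin n) = atOrigin n := by
      funext a; simp [LabeledChipFiring.mirror, atOrigin]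
    rw [this]
    exact Relation.ReflTransGen.refl
  | tail _ hpq ih => exact Relation.ReflTransGen.tail ih hpq.mirror

lemma IsFinal.mirror (h : IsFinal r p) : IsFinal r (mirror p) := fun q hq => by
  have := hq.mirror
  rw [mirror_mirror] at this
  exact h _ this

theorem weaklySorted_of_isFinal (hr : 1 ≤ r) (hm : 1 ≤ m) (hn : n = r * (4 * m - 1))
    (h : Reachable r p) (hp : IsFinal r p) : WeaklySorted p := by
  intro a b hab
  by_contra hc
  rcases lt_or_ge (p b) 0 with hb | hb
  · have := neg_le_of_reachable hr hm hn h b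
    -- The threshold t-m is the site just right of b, so b is small; then so is a, which must end no
    -- further right.
    obtain ⟨t, ht⟩ : ∃ t : ℕ, (t : ℤ) = p b + m + 1 := ⟨(p b + m + 1).toNat, by omega⟩
    have key := fun c => lt_iff_of_isFinal hr hn h hp (t := t) (by omega) (by omega) c
    have h1 := (key b).mp (by omega)
    have h2 := (key a).mpr (lt_trans hab h1)
    omega
  · have := neg_le_of_reachable hr hm hn h.mirror (Fin.rev a)
    rw [mirror, Fin.rev_rev] at this
    obtain ⟨t, ht⟩ : ∃ t : ℕ, (t : ℤ) = m + 1 - p a := ⟨(m + 1 - p a).toNat, by omega⟩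
    have key := fun c => lt_iff_of_isFinal hr hn h.mirror hp.mirror (t := t)
      (by omega) (by omega) (Fin.rev c)
    simp only [mirror, Fin.rev_rev] at key
    have h1 := (key a).mp (by omega)
    have h2 := (key b).mpr (lt_trans (Fin.rev_lt_rev.mpr hab) h1)
    omega

end LabeledChipFiring

theorem mainTheorem7 (r n : ℕ) (hr : 1 ≤ r) (hn : n ≡ 3 * r [MOD 4 * r]) :
    (¬ ∃ c : ℕ → LabeledChipFiring.Config n,
        c 0 = LabeledChipFiring.atOrigin n ∧
          ∀ t : ℕ, LabeledChipFiring.Fires r (c t) (c (t + 1))) ∧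
      ∀ p : LabeledChipFiring.Config n,
        LabeledChipFiring.Reachable r p → LabeledChipFiring.IsFinal r p →
          LabeledChipFiring.WeaklySorted p := by
  obtain ⟨m, hm, hnm⟩ : ∃ m : ℕ, 1 ≤ m ∧ n = r * (4 * m - 1) := by
    have h1 : n % (4 * r) = 3 * r := by
      rw [hn, Nat.mod_eq_of_lt (by omega)]
    have h2 := Nat.div_add_mod n (4 * r)
    refine ⟨n / (4 * r) + 1, Nat.le_add_left _ _, ?_⟩
    rw [show 4 * (n / (4 * r) + 1) - 1 = 4 * (n / (4 * r)) + 3 by omega]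
    rw [h1] at h2
    linarith
  exact ⟨LabeledChipFiring.not_exists_infinite hr hm hnm,
    fun p h hp => LabeledChipFiring.weaklySorted_of_isFinal hr hm hnm h hp⟩
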